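/- All rings are commutative with identity. Let $R$ be a ring, $M$ an $R$-module and $\mathbf{x}=x_1,\dots,x_\ell$ a finite sequence in $R$. The sequence $\mathbf{x}$ is \emph{$M$-weakly proregular} if for each $n$ there is $m\ge n$ such that the natural map of Koszul homology modules $H_i(\mathbf{x}^m,M)\to H_i(\mathbf{x}^n,M)$ is zero for all $i\ge 1$. It is a \emph{parameter sequence on $M$} if it is $M$-weakly proregular, $\mathbf{x}M\ne M$, and the top \v{C}ech cohomology satisfies $H^{\ell}_{\mathbf{x}}(M)_{\mathfrak p}\ne 0$ for every prime $\mathfrak p\in\operatorname{Supp}_R(M/\mathbf{x}M)$. It is a \emph{strong parameter sequence on $M$} if $x_1,\dots,x_i$ is a parameter sequence on $M$ for all $i=1,\dots,\ell$. The module $M$ is \emph{Cohen--Macaulay} if every strong parameter sequence on $M$ is an $M$-regular sequence (the empty sequence counts as regular on every module). (1) Let $R\to S$ be a faithfully flat ring homomorphism and $M$ an $R$-module. If $M\otimes_R S$ is a Cohen--Macaulay $S$-module, then $M$ is a Cohen--Macaulay $R$-module. (2) Let $(R,\mathfrak m)$ be a quasi-local ring whose $\mathfrak m$-adic completion $\widehat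 R$ is flat over $R$; in particular, $(R,\mathfrak m)$ may be any Noetherian local ring. Let $M$ be an $R$-module. If $M\otimes_R\widehat R$ is a Cohen--Macaulay $\widehat R$-module, then $M$ is a Cohen--Macaulay $R$-module. (3) Let $R$ be a ring, $M$ an $R$-module and $t$ an indeterminate over $R$. If $M\otimes_R R[t]$ is a Cohen--Macaulay $R[t]$-module, then $M$ is a Cohen--Macaulay $R$-module. -/

import Mathlib

open scoped TensorProduct

universe u v w

noncomputable section

namespace HMCohenMacaulay

/-- The position sign `(-1)^{#{k ∈ T : k < j}}`. -/
def posSign (R : Type*) [CommRing R] {l : ℕ} (T : Finset (Fin l)) (j : Fin l) : R :=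
  (-1) ^ (T.filter (· < j)).card

theorem posSign_insert (R : Type*) [CommRing R] {l : ℕ} (T : Finset (Fin l)) {j k : Fin l}
    (hj : j ∉ T) :
    posSign R (insert j T) k = (if j < k then -1 else 1) * posSign R T k := by
  unfold posSign
  rw [Finset.filter_insert]
  split_ifs with h
  · rw [Finset.card_insert_of_notMem (by simp [hj]), pow_succ, mul_comm]
  · rw [one_mul]

theorem posSign_swap (R : Type*) [CommRing R] {l : ℕ} (T : Finset (Fin l)) {j k : Fin l}
    (hj : j ∉ T) (hk : k ∉ T) (hjk : j ≠ k) :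
    posSign R T j * posSign R (insert j T) k + posSign R T k * posSign R (insert k T) j = 0 := by
  rw [posSign_insert R T hj, posSign_insert R T hk]
  rcases lt_or_gt_of_ne hjk with h | h
  · rw [if_pos h, if_neg h.not_gt]; ring
  · rw [if_pos h, if_neg h.not_gt]; ring

/-! ### The Koszul complex -/

/-- The subsets of `{0, …, l-1}` with `i` elements; they index the standard basis
`e_T = e_{t₁} ∧ ⋯ ∧ e_{tᵢ}` of the degree `i` part of the Koszul complex. -/
abbrev Subsets (l i : ℕ) : Type := {T : Finset (Fin l) // T.card = i}

section Koszul

variable {R : Type*} [CommRing R] {l : ℕ} (x : Fin l → R) (M : Type*) [AddCommGroup M] [Module R M]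

/-- The differential `K_{i+1}(x, M) → K_i(x, M)` of the Koszul complex, where
`K_i(x, M) = ⨁_{|T| = i} M e_T`. It sends
`m e_{t₀} ∧ ⋯ ∧ e_{tᵢ}` to `∑ₖ (-1)ᵏ x_{tₖ} m e_{t₀} ∧ ⋯ (omit e_{tₖ}) ⋯ ∧ e_{tᵢ}`. -/
def koszulD (i : ℕ) : (Subsets l (i + 1) → M) →ₗ[R] (Subsets l i → M) :=
  LinearMap.pi fun T => ∑ j : {j : Fin l // j ∉ T.1},
    (posSign R T.1 j.1 * x j.1) •
      LinearMap.proj (R := R) (φ := fun _ : Subsets l (i + 1) => M)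
        ⟨insert j.1 T.1, by rw [Finset.card_insert_of_notMem j.2, T.2]⟩

theorem koszulD_apply (i : ℕ) (f : Subsets l (i + 1) → M) (T : Subsets l i) :
    koszulD x M i f T = ∑ j : {j : Fin l // j ∉ T.1}, (posSign R T.1 j.1 * x j.1) •
      f ⟨insert j.1 T.1, by rw [Finset.card_insert_of_notMem j.2, T.2]⟩ := by
  simp [koszulD, LinearMap.sum_apply]

theorem koszulD_comp (i : ℕ) : koszulD x M i ∘ₗ koszulD x M (i + 1) = 0 := by
  refine LinearMap.ext fun f => ?_
  funext T
  simp only [LinearMap.comp_apply, koszulD_apply, Finset.smul_sum, smul_smul]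
  rw [Finset.sum_sigma', LinearMap.zero_apply, Pi.zero_apply]
  have h1 : ∀ a : (j : {j : Fin l // j ∉ T.1}) × {k : Fin l // k ∉ insert j.1 T.1},
      a.2.1 ∉ T.1 := fun a h => a.2.2 (Finset.mem_insert_of_mem h)
  have h2 : ∀ a : (j : {j : Fin l // j ∉ T.1}) × {k : Fin l // k ∉ insert j.1 T.1},
      a.1.1 ≠ a.2.1 := fun a h => a.2.2 (h ▸ Finset.mem_insert_self _ _)
  refine Finset.sum_involution
    (fun a _ => ⟨⟨a.2.1, h1 a⟩, ⟨a.1.1, by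
      simpa [Finset.mem_insert] using ⟨h2 a, a.1.2⟩⟩⟩) ?_ ?_ ?_ ?_
  · intro a _
    dsimp only
    have e : (insert a.1.1 (insert a.2.1 T.1)) = insert a.2.1 (insert a.1.1 T.1) :=
      Finset.insert_comm _ _ _
    simp only [e, ← add_smul]
    convert zero_smul R _ using 2
    linear_combination (x a.1.1 * x a.2.1) * posSign_swap R T.1 a.1.2 (h1 a) (h2 a)
  · intro a _ _ h
    exact h2 a (congrArg (fun b => b.1.1) h).symm
  · intro a _; simp
  · intro a _; rfl

/-- The cycles in degree `i` of the Koszul complex. -/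
def koszulCycles : (i : ℕ) → Submodule R (Subsets l i → M)
  | 0 => ⊤
  | i + 1 => LinearMap.ker (koszulD x M i)

/-- Koszul homology `H_i(x, M)`: cycles modulo boundaries. -/
abbrev KoszulHomology (i : ℕ) : Type _ :=
  koszulCycles x M i ⧸ (LinearMap.range (koszulD x M i)).submoduleOf (koszulCycles x M i)

/-- The degree `i` component `K_i(x^m, M) → K_i(x^n, M)` of the chain map `φ_n^m` (for `n ≤ m`):
it is the tensor product of the maps which are `x_j^{m-n}` in degree `1` and the identity in
degree `0`, so that `m e_T` is sent to `(∏_{j ∈ T} x_j^{m-n}) m e_T`. -/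
def koszulPow (m n i : ℕ) : (Subsets l i → M) →ₗ[R] (Subsets l i → M) :=
  LinearMap.pi fun T => (∏ j ∈ T.1, x j ^ (m - n)) •
    LinearMap.proj (R := R) (φ := fun _ : Subsets l i => M) T

theorem koszulPow_comm {m n : ℕ} (h : n ≤ m) (i : ℕ) :
    koszulD (fun j => x j ^ n) M i ∘ₗ koszulPow x M m n (i + 1) =
      koszulPow x M m n i ∘ₗ koszulD (fun j => x j ^ m) M i := by
  refine LinearMap.ext fun f => ?_
  funext T
  simp only [LinearMap.comp_apply, koszulPow, koszulD_apply, LinearMap.pi_apply,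
    LinearMap.smul_apply, LinearMap.proj_apply, Finset.smul_sum, smul_smul]
  refine Finset.sum_congr rfl fun j _ => ?_
  congr 1
  rw [Finset.prod_insert j.2, ← Nat.add_sub_cancel' h, pow_add, Nat.add_sub_cancel_left]
  ring

theorem koszulPow_mem_cycles {m n : ℕ} (h : n ≤ m) : ∀ (i : ℕ) (f : Subsets l i → M),
    f ∈ koszulCycles (fun j => x j ^ m) M i →
      koszulPow x M m n i f ∈ koszulCycles (fun j => x j ^ n) M i
  | 0, _, _ => Submodule.mem_top
  | i + 1, f, hf => by
    have := LinearMap.congr_fun (koszulPow_comm x M h i) f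
    simp only [LinearMap.comp_apply] at this
    change koszulD _ M i f = 0 at hf
    change koszulD _ M i _ = 0
    rw [this, hf, map_zero]

/-- The map `H_i(x^m, M) → H_i(x^n, M)` induced by the chain map `φ_n^m`, for `n ≤ m`. -/
def koszulHomologyMap {m n : ℕ} (h : n ≤ m) (i : ℕ) :
    KoszulHomology (fun j => x j ^ m) M i →ₗ[R] KoszulHomology (fun j => x j ^ n) M i :=
  Submodule.mapQ _ _ ((koszulPow x M m n i).restrict (koszulPow_mem_cycles x M h i)) (by
    rintro ⟨f, hf⟩ ⟨g, hg⟩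
    refine ⟨koszulPow x M m n (i + 1) g, ?_⟩
    have := LinearMap.congr_fun (koszulPow_comm x M h i) g
    simp only [LinearMap.comp_apply] at this
    rw [this, hg]
    rfl)

/-- The finite sequence `x` is `M`-weakly proregular. -/
def IsWeaklyProregular : Prop :=
  ∀ n : ℕ, ∃ (m : ℕ) (h : n ≤ m), ∀ i : ℕ, 1 ≤ i → koszulHomologyMap x M h i = 0

end Koszul

/-! ### The Čech complex -/

section Cech

variable {R : Type*} [CommRing R] {l : ℕ} (x : Fin l → R) (M : Type*) [AddCommGroup M] [Module R M]

/-- The localization of `M` at the multiplicative set generated by the `x_j` with `j ∈ T`,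
that is, the localization `M_{x_T}` with `x_T = ∏_{j ∈ T} x_j`. -/
abbrev CechTerm (T : Finset (Fin l)) : Type _ :=
  LocalizedModule (Submonoid.closure (x '' (T : Set (Fin l)))) M

/-- The canonical map `M_{x_U} → M_{x_T}` for `U ⊆ T`. -/
def cechRes {U T : Finset (Fin l)} (h : U ⊆ T) : CechTerm x M U →ₗ[R] CechTerm x M T :=
  LocalizedModule.liftOfLE _ _ (Submonoid.closure_mono (Set.image_mono (Finset.coe_subset.2 h)))

/-- The differential `C^i(x; M) → C^{i+1}(x; M)` of the Čech complex, where
`C^i(x; M) = ⨁_{|T| = i} M_{x_T}`: an alternating sum of canonical localization maps. -/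
def cechD (i : ℕ) : ((T : Subsets l i) → CechTerm x M T.1) →ₗ[R]
    ((T : Subsets l (i + 1)) → CechTerm x M T.1) :=
  LinearMap.pi fun T => ∑ j : {j : Fin l // j ∈ T.1},
    posSign R T.1 j.1 • (cechRes x M (Finset.erase_subset j.1 T.1) ∘ₗ
      LinearMap.proj (R := R) (φ := fun U : Subsets l i => CechTerm x M U.1)
        ⟨T.1.erase j.1, by rw [Finset.card_erase_of_mem j.2, T.2, Nat.add_sub_cancel]⟩)

theorem cechD_apply (i : ℕ) (f : (T : Subsets l i) → CechTerm x M T.1) (T : Subsets l (i + 1)) :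
    cechD x M i f T = ∑ j : {j : Fin l // j ∈ T.1},
      posSign R T.1 j.1 • cechRes x M (Finset.erase_subset j.1 T.1)
        (f ⟨T.1.erase j.1, by rw [Finset.card_erase_of_mem j.2, T.2, Nat.add_sub_cancel]⟩) := by
  simp [cechD, LinearMap.sum_apply]

theorem cechRes_cechRes {U V T : Finset (Fin l)} (h : U ⊆ V) (h' : V ⊆ T) (m : CechTerm x M U) :
    cechRes x M h' (cechRes x M h m) = cechRes x M (h.trans h') m := by
  obtain ⟨⟨a, s⟩, rfl⟩ := IsLocalizedModule.mk'_surjective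
    (Submonoid.closure (x '' (U : Set (Fin l)))) (LocalizedModule.mkLinearMap _ M) m
  simp [cechRes, LocalizedModule.liftOfLE]

theorem cechD_comp (i : ℕ) : cechD x M (i + 1) ∘ₗ cechD x M i = 0 := by
  refine LinearMap.ext fun f => ?_
  funext T
  simp only [LinearMap.comp_apply, cechD_apply, map_sum, map_smul, Finset.smul_sum, smul_smul,
    cechRes_cechRes]
  rw [Finset.sum_sigma', LinearMap.zero_apply, Pi.zero_apply]
  have h1 : ∀ a : (j : {j : Fin l // j ∈ T.1}) × {k : Fin l // k ∈ T.1.erase j.1},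
      a.2.1 ∈ T.1 := fun a => Finset.mem_of_mem_erase a.2.2
  have h2 : ∀ a : (j : {j : Fin l // j ∈ T.1}) × {k : Fin l // k ∈ T.1.erase j.1},
      a.1.1 ≠ a.2.1 := fun a => (Finset.ne_of_mem_erase a.2.2).symm
  have key : ∀ (U V : Subsets l i) (hU : U.1 ⊆ T.1) (hV : V.1 ⊆ T.1), U = V →
      cechRes x M hU (f U) = cechRes x M hV (f V) := by
    rintro U V hU hV rfl; rfl
  refine Finset.sum_involution
    (fun a _ => ⟨⟨a.2.1, h1 a⟩, ⟨a.1.1, Finset.mem_erase.2 ⟨h2 a, a.1.2⟩⟩⟩) ?_ ?_ ?_ ?_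
  · intro a _
    dsimp only
    set W := (T.1.erase a.1.1).erase a.2.1 with hW
    have eW : (T.1.erase a.2.1).erase a.1.1 = W := Finset.erase_right_comm
    have n1 : a.1.1 ∉ W := by simp [hW]
    have n2 : a.2.1 ∉ W := by simp [hW]
    have e1 : T.1.erase a.1.1 = insert a.2.1 W := (Finset.insert_erase a.2.2).symm
    have e2 : T.1.erase a.2.1 = insert a.1.1 W := by
      rw [← eW, Finset.insert_erase (Finset.mem_erase.2 ⟨h2 a, a.1.2⟩)]
    have e3 : T.1 = insert a.1.1 (insert a.2.1 W) := by
      rw [← e1, Finset.insert_erase a.1.2]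
    have cW : W.card = i := by
      rw [hW, Finset.card_erase_of_mem a.2.2, Finset.card_erase_of_mem a.1.2, T.2]; omega
    rw [key ⟨(T.1.erase a.2.1).erase a.1.1, _⟩ ⟨W, cW⟩ _
      ((Finset.erase_subset _ _).trans (Finset.erase_subset _ _)) (Subtype.ext eW), ← add_smul]
    convert zero_smul R _ using 2
    have s1 : posSign R T.1 a.1.1 = posSign R (insert a.2.1 W) a.1.1 :=
      (congrArg (fun V => posSign R V a.1.1) e3).trans (by
        rw [posSign_insert R _ (by simp [n1, h2 a]), if_neg (lt_irrefl _), one_mul])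
    have s2 : posSign R T.1 a.2.1 = posSign R (insert a.1.1 W) a.2.1 :=
      (congrArg (fun V => posSign R V a.2.1) (e3.trans (Finset.insert_comm _ _ _))).trans (by
        rw [posSign_insert R _ (by simp [n2, (h2 a).symm]), if_neg (lt_irrefl _), one_mul])
    have t1 : posSign R (T.1.erase a.1.1) a.2.1 = posSign R W a.2.1 :=
      (congrArg (fun V => posSign R V a.2.1) e1).trans (by
        rw [posSign_insert R _ n2, if_neg (lt_irrefl _), one_mul])
    have t2 : posSign R (T.1.erase a.2.1) a.1.1 = posSign R W a.1.1 :=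
      (congrArg (fun V => posSign R V a.1.1) e2).trans (by
        rw [posSign_insert R _ n1, if_neg (lt_irrefl _), one_mul])
    rw [s1, s2, t1, t2]
    linear_combination posSign_swap R W n1 n2 (h2 a)
  · intro a _ _ h
    exact h2 a (congrArg (fun b => b.1.1) h).symm
  · intro a _; simp
  · intro a _; rfl

/-- The coboundaries in degree `i` of the Čech complex. -/
def cechCoboundaries : (i : ℕ) → Submodule R ((T : Subsets l i) → CechTerm x M T.1)
  | 0 => ⊥
  | i + 1 => LinearMap.range (cechD x M i)

/-- Čech cohomology `H^i_x(M)`: cocycles modulo coboundaries. -/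
abbrev CechCohomology (i : ℕ) : Type _ :=
  LinearMap.ker (cechD x M i) ⧸ (cechCoboundaries x M i).submoduleOf (LinearMap.ker (cechD x M i))

end Cech

/-! ### Parameter sequences and Cohen–Macaulay modules -/

section CohenMacaulay

variable {R : Type*} [CommRing R] {l : ℕ} (x : Fin l → R) (M : Type*) [AddCommGroup M] [Module R M]

/-- The submodule `xM` of `M`. -/
def seqSMul : Submodule R M := Ideal.span (Set.range x) • (⊤ : Submodule R M)

/-- `x` is a parameter sequence on `M`. -/
structure IsParameterSequence : Prop where
  weaklyProregular : IsWeaklyProregular x M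
  ne_top : seqSMul x M ≠ ⊤
  cech_ne_zero : ∀ p ∈ Module.support R (M ⧸ seqSMul x M),
    Nontrivial (LocalizedModule p.asIdeal.primeCompl (CechCohomology x M l))

/-- `x` is a strong parameter sequence on `M`: every initial part `x₁, …, xᵢ` with
`1 ≤ i ≤ l` is a parameter sequence on `M`. (The empty sequence is one on every module.) -/
def IsStrongParameterSequence : Prop :=
  ∀ (i : ℕ) (h : i ≤ l), 1 ≤ i → IsParameterSequence (fun j : Fin i => x (Fin.castLE h j)) M

/-- `x` is an `M`-regular sequence; the empty sequence counts as regular on every module,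
including the zero module. -/
def IsRegularSequence : Prop :=
  l = 0 ∨ RingTheory.Sequence.IsRegular M (List.ofFn x)

variable (R) in
/-- `M` is a Cohen–Macaulay `R`-module (in the sense of Hamilton and Marley): every strong
parameter sequence on `M` is an `M`-regular sequence. -/
def IsCohenMacaulay : Prop :=
  ∀ (l : ℕ) (x : Fin l → R), IsStrongParameterSequence x M → IsRegularSequence x M

end CohenMacaulay

end HMCohenMacaulay

end

noncomputable section

namespace HMCohenMacaulay

/-! ### Koszul complexes and weak proregularity under base change. -/

section Koszul

/-! Strong parameter sequences on `M` remain so on `S ⊗ M` when `R → S` is faithfully flat. There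
they are regular by hypothesis, and weak regularity descends because tensoring with `S` reflects
injectivity; `xM ≠ M` is already part of being a parameter sequence.

The three conditions on a parameter sequence ascend separately. For weak proregularity, the Koszul
complex commutes with base change and flatness preserves its cycles. For `xM ≠ M`, faithful flatness
is used. For the Čech condition, no isomorphism of cohomology is needed: the surjection `H^l(S ⊗ M)
→ S ⊗ H^l(M)` suffices, since the support of a quotient lies in that of its source. A prime `q` in
the support of `(S ⊗ M)/x(S ⊗ M)` contracts into the support of `M/xM`, hence of `H^l(M)`, and
flatness lifts this back to `q`.

The other parts are instances: a flat completion of a local ring is faithfully flat because the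
residue field survives, and so are polynomial rings. -/

theorem algebraMap_posSign (R S : Type*) [CommRing R] [CommRing S] [Algebra R S] {l : ℕ}
    (T : Finset (Fin l)) (j : Fin l) : algebraMap R S (posSign R T j) = posSign S T j := by
  simp [posSign]

variable {R : Type*} [CommRing R] {l : ℕ} (x : Fin l → R) (M : Type*) [AddCommGroup M] [Module R M]
variable (S : Type*) [CommRing S] [Algebra R S]

/-- Trades the quotient for cycles and boundaries, so that base change can be argued on elements. -/
theorem koszulHomologyMap_eq_zero_iff {m n : ℕ} (h : n ≤ m) (i : ℕ) :
    koszulHomologyMap x M h i = 0 ↔ ∀ f ∈ koszulCycles (fun j => x j ^ m) M i,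
      koszulPow x M m n i f ∈ LinearMap.range (koszulD (fun j => x j ^ n) M i) := by
  constructor
  · intro h0 f hf
    have e : koszulHomologyMap x M h i (Submodule.Quotient.mk ⟨f, hf⟩) =
      Submodule.Quotient.mk ⟨_, koszulPow_mem_cycles x M h i f hf⟩ := rfl
    rw [h0, LinearMap.zero_apply, eq_comm, Submodule.Quotient.mk_eq_zero] at e
    exact e
  · intro h0
    refine LinearMap.ext fun z => ?_
    obtain ⟨⟨f, hf⟩, rfl⟩ := Submodule.Quotient.mk_surjective _ z
    exact (Submodule.Quotient.mk_eq_zero _).2 (h0 f hf)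

/-- The isomorphism `S ⊗ K_i(x, M) ≃ K_i(x, S ⊗ M)`. -/
abbrev koszulBaseChange (l i : ℕ) :
    S ⊗[R] (Subsets l i → M) ≃ₗ[S] (Subsets l i → S ⊗[R] M) :=
  TensorProduct.piRight R S S (fun _ : Subsets l i => M)

theorem koszulD_baseChange (i : ℕ) (z : S ⊗[R] (Subsets l (i + 1) → M)) :
    koszulD (fun j => algebraMap R S (x j)) (S ⊗[R] M) i (koszulBaseChange M S l (i + 1) z) =
      koszulBaseChange M S l i ((koszulD x M i).baseChange S z) := by
  induction z with
  | zero => simp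
  | add a b ha hb => simp only [map_add, ha, hb]
  | tmul s f =>
    funext T
    simp only [koszulD_apply, TensorProduct.piRight_apply, TensorProduct.piRightHom_tmul,
      LinearMap.baseChange_tmul, TensorProduct.tmul_sum]
    refine Finset.sum_congr rfl fun j _ => ?_
    rw [← algebraMap_posSign R S, ← map_mul, algebraMap_smul, TensorProduct.tmul_smul]

theorem koszulPow_baseChange (m n i : ℕ) (z : S ⊗[R] (Subsets l i → M)) :
    koszulPow (fun j => algebraMap R S (x j)) (S ⊗[R] M) m n i (koszulBaseChange M S l i z) =
      koszulBaseChange M S l i ((koszulPow x M m n i).baseChange S z) := by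
  induction z with
  | zero => simp
  | add a b ha hb => simp only [map_add, ha, hb]
  | tmul s f =>
    funext T
    simp only [koszulPow, LinearMap.pi_apply, LinearMap.smul_apply, LinearMap.proj_apply,
      TensorProduct.piRight_apply, TensorProduct.piRightHom_tmul, LinearMap.baseChange_tmul]
    simp only [← map_pow, ← map_prod, algebraMap_smul, TensorProduct.tmul_smul]

variable {x M} in
/-- Weak proregularity is preserved by flat base change. -/
theorem IsWeaklyProregular.baseChange [Module.Flat R S] (hx : IsWeaklyProregular x M) :
    IsWeaklyProregular (fun j => algebraMap R S (x j)) (S ⊗[R] M) := by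
  intro n
  obtain ⟨m, hnm, hm⟩ := hx n
  refine ⟨m, hnm, fun i hi => (koszulHomologyMap_eq_zero_iff _ _ _ _).2 fun f hf => ?_⟩
  obtain ⟨i, rfl⟩ : ∃ k, i = k + 1 := ⟨i - 1, by omega⟩
  have key := (koszulHomologyMap_eq_zero_iff _ _ _ _).1 (hm (i + 1) hi)
  obtain ⟨z, rfl⟩ := (koszulBaseChange M S l (i + 1)).surjective f
  change koszulD _ _ i _ = 0 at hf
  simp only [← map_pow] at hf ⊢
  rw [koszulD_baseChange (fun j => x j ^ m), LinearEquiv.map_eq_zero_iff] at hf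
  -- By flatness, cycles over `S` come from `S ⊗` (cycles over `R`), so it is enough to treat pure
  -- tensors.
  obtain ⟨t, rfl⟩ := (Module.Flat.lTensor_exact S
    (LinearMap.exact_subtype_ker_map (koszulD (fun j => x j ^ m) M i)) z).1 hf
  rw [koszulPow_baseChange]
  induction t with
  | zero => simp
  | add a b ha hb =>
    simp only [map_add] at hf ⊢
    -- Each summand must again be a cycle; this holds for the image of any element of `S ⊗ ker`.
    have h1 : ∀ c, (LinearMap.baseChange S (koszulD (fun j => x j ^ m) M i))
        (LinearMap.lTensor S (koszulD (fun j => x j ^ m) M i).ker.subtype c) = 0 := fun c =>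
      (Module.Flat.lTensor_exact S (LinearMap.exact_subtype_ker_map _) _).2 ⟨c, rfl⟩
    exact add_mem (ha (h1 a)) (hb (h1 b))
  | tmul s g =>
    obtain ⟨g, hg⟩ := g
    obtain ⟨k, hk⟩ := key g hg
    refine ⟨koszulBaseChange M S l (i + 1 + 1) (s ⊗ₜ k), ?_⟩
    rw [koszulD_baseChange (fun j => x j ^ n)]
    simp only [LinearMap.baseChange_tmul, LinearMap.lTensor_tmul, Submodule.subtype_apply, hk]

end Koszul

/-! ### Supports under base change. -/

section Support

variable {R : Type*} [CommRing R] {S : Type*} [CommRing S] [Algebra R S]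
  {N : Type*} [AddCommGroup N] [Module R N]

theorem comap_mem_support_of_mem_support_tensorProduct {q : PrimeSpectrum S}
    (hq : q ∈ Module.support S (S ⊗[R] N)) :
    PrimeSpectrum.comap (algebraMap R S) q ∈ Module.support R N := by
  contrapose! hq
  rw [Module.notMem_support_iff'] at hq ⊢
  intro z
  induction z with
  | zero => exact ⟨1, q.isPrime.one_notMem, by simp⟩
  | tmul s n =>
    obtain ⟨r, hr, h0⟩ := hq n
    refine ⟨algebraMap R S r, hr, ?_⟩
    rw [algebraMap_smul, ← TensorProduct.tmul_smul, h0, TensorProduct.tmul_zero]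
  | add a b ha hb =>
    obtain ⟨r, hr, h0⟩ := ha
    obtain ⟨t, ht, h1⟩ := hb
    refine ⟨r * t, fun h => (q.isPrime.mem_or_mem h).elim hr ht, ?_⟩
    rw [smul_add, mul_smul, mul_smul, smul_comm, h0, h1]
    simp

/-- Flatness gives `Ann(1 ⊗ n) = Ann(n) S`. If `Ann(n)` lies in the contraction of `q`, then `Ann(n)
S` lies in `q`. -/
theorem mem_support_tensorProduct_of_flat [Module.Flat R S] {q : PrimeSpectrum S}
    (hq : PrimeSpectrum.comap (algebraMap R S) q ∈ Module.support R N) :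
    q ∈ Module.support S (S ⊗[R] N) := by
  rw [Module.mem_support_iff'] at hq ⊢
  obtain ⟨n, hn⟩ := hq
  refine ⟨1 ⊗ₜ n, fun s hs h0 => hs ?_⟩
  -- `Ann(n)` is the kernel of `r ↦ r n`; tensoring with `S` keeps this exact.
  obtain ⟨t, ht⟩ := (Module.Flat.lTensor_exact S
    (LinearMap.exact_subtype_ker_map (LinearMap.toSpanSingleton R N n)) (s ⊗ₜ (1 : R))).1 (by
      simpa [TensorProduct.smul_tmul'] using h0)
  have : ∀ t, TensorProduct.rid R S
      (LinearMap.lTensor S (LinearMap.toSpanSingleton R N n).ker.subtype t) ∈ q.asIdeal := by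
    intro t
    induction t with
    | zero => simp
    | add a b ha hb => simpa only [map_add] using add_mem ha hb
    | tmul s r =>
      have hr : r.1 ∈ (PrimeSpectrum.comap (algebraMap R S) q).asIdeal := by
        by_contra h
        exact hn r.1 h r.2
      simpa [Algebra.smul_def] using Ideal.mul_mem_right s _ hr
  simpa [ht] using this t

end Support

/-! ### Descent of weak regularity. -/

section Regular

variable {R : Type*} [CommRing R] (S : Type*) [CommRing S] [Algebra R S]

/-- Induction on the sequence, with `M` varying: `S ⊗ (M/rM)` is `(S ⊗ M)/r(S ⊗ M)`, and injectivity
of multiplication by `r` is reflected by `S ⊗ -`. -/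
theorem isWeaklyRegular_of_faithfullyFlat [Module.FaithfullyFlat R S]
    {M : Type*} [AddCommGroup M] [Module R M] {rs : List R}
    (h : RingTheory.Sequence.IsWeaklyRegular (S ⊗[R] M) (rs.map (algebraMap R S))) :
    RingTheory.Sequence.IsWeaklyRegular M rs := by
  induction rs generalizing M with
  | nil => simp
  | cons r rs ih =>
    simp only [List.map_cons, RingTheory.Sequence.isWeaklyRegular_cons_iff] at h ⊢
    refine ⟨?_, ih (((QuotSMulTop.algebraMapTensorEquivTensorQuotSMulTop r M S
      ).isWeaklyRegular_congr _).1 h.2)⟩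
    refine (Module.FaithfullyFlat.lTensor_injective_iff_injective R S
      (LinearMap.lsmul R M r)).1 ?_
    have e : ⇑(LinearMap.lTensor S (LinearMap.lsmul R M r)) =
        fun z : S ⊗[R] M => algebraMap R S r • z := ?_
    · rw [e]; exact h.1
    funext z
    induction z with
    | zero => simp
    | add a b ha hb => simp only [map_add, smul_add, ha, hb]
    | tmul s m => simp

end Regular


/-! ### Čech terms and top Čech cohomology under base change. -/

section Cech

variable {R : Type*} [CommRing R] {l : ℕ} (x : Fin l → R) (M : Type*) [AddCommGroup M] [Module R M]
variable (S : Type*) [CommRing S] [Algebra R S]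

theorem closure_algebraMap_image (T : Finset (Fin l)) :
    Submonoid.closure ((fun j => algebraMap R S (x j)) '' (T : Set (Fin l))) =
      (Submonoid.closure (x '' (T : Set (Fin l)))).map (algebraMap R S : R →* S) := by
  rw [MonoidHom.map_mclosure, Set.image_image]
  rfl

/-- Stated for `U ⊆ T` because comparing restriction maps needs maps out of the localization at `U`
into the term at `T`. -/
theorem isUnit_algebraMap_end_tensor_cechTerm {U T : Finset (Fin l)} (h : U ⊆ T)
    (w : Submonoid.closure ((fun j => algebraMap R S (x j)) '' (U : Set (Fin l)))) :
    IsUnit (algebraMap S (Module.End S (S ⊗[R] CechTerm x M T)) w) := by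
  obtain ⟨w, hw⟩ := w
  rw [closure_algebraMap_image] at hw
  obtain ⟨r, hr, rfl⟩ := hw
  have hu := (IsLocalizedModule.map_units (LocalizedModule.mkLinearMap
    (Submonoid.closure (x '' (T : Set (Fin l)))) M)
    ⟨r, Submonoid.closure_mono (Set.image_mono (Finset.coe_subset.2 h)) hr⟩).map
    (Module.End.baseChangeHom R S (CechTerm x M T))
  convert hu using 1
  refine LinearMap.ext fun z => ?_
  induction z with
  | zero => simp
  | add a b ha hb => rw [map_add, map_add, ha, hb]
  | tmul s m => simp [Module.algebraMap_end_apply, Module.End.baseChangeHom]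

/-- The canonical map `(S ⊗ M)_{x_T} → S ⊗ M_{x_T}`. -/
def cechTermToTensor (T : Finset (Fin l)) :
    CechTerm (fun j => algebraMap R S (x j)) (S ⊗[R] M) T →ₗ[S] S ⊗[R] CechTerm x M T :=
  IsLocalizedModule.lift _ (LocalizedModule.mkLinearMap _ _)
    ((LocalizedModule.mkLinearMap _ M).baseChange S)
    (isUnit_algebraMap_end_tensor_cechTerm x M S subset_rfl)

theorem cechTermToTensor_mk (T : Finset (Fin l)) (z : S ⊗[R] M) :
    cechTermToTensor x M S T (LocalizedModule.mkLinearMap _ _ z) =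
      (LocalizedModule.mkLinearMap _ M).baseChange S z :=
  IsLocalizedModule.lift_apply _ _ _ _ _

theorem cechTermToTensor_surjective (T : Finset (Fin l)) :
    Function.Surjective (cechTermToTensor x M S T) := by
  intro z
  induction z with
  | zero => exact ⟨0, map_zero _⟩
  | add a b ha hb =>
    obtain ⟨a, rfl⟩ := ha
    obtain ⟨b, rfl⟩ := hb
    exact ⟨a + b, map_add _ _ _⟩
  | tmul s m =>
    obtain ⟨⟨m, r⟩, rfl⟩ := IsLocalizedModule.mk'_surjective
      (Submonoid.closure (x '' (T : Set (Fin l)))) (LocalizedModule.mkLinearMap _ M) m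
    have hr : algebraMap R S r.1 ∈
        Submonoid.closure ((fun j => algebraMap R S (x j)) '' (T : Set (Fin l))) := by
      rw [closure_algebraMap_image]
      exact ⟨r.1, r.2, rfl⟩
    refine ⟨IsLocalizedModule.mk' (LocalizedModule.mkLinearMap (Submonoid.closure
      ((fun j => algebraMap R S (x j)) '' (T : Set (Fin l)))) _) (s ⊗ₜ m) ⟨_, hr⟩, ?_⟩
    -- Multiplication by the denominator is bijective on the target, so equality may be checked
    -- after clearing it.
    refine ((Module.End.isUnit_iff _).1
      (isUnit_algebraMap_end_tensor_cechTerm x M S subset_rfl ⟨_, hr⟩)).1 ?_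
    simp only [Module.algebraMap_end_apply, Function.uncurry]
    have h1 := IsLocalizedModule.mk'_cancel' (LocalizedModule.mkLinearMap (Submonoid.closure
      ((fun j => algebraMap R S (x j)) '' (T : Set (Fin l)))) (S ⊗[R] M))
      (s ⊗ₜ[R] m) ⟨_, hr⟩
    have h2 := IsLocalizedModule.mk'_cancel' (LocalizedModule.mkLinearMap
      (Submonoid.closure (x '' (T : Set (Fin l)))) M) m r
    rw [Submonoid.smul_def] at h1 h2
    rw [← map_smul, h1, cechTermToTensor_mk, LinearMap.baseChange_tmul, algebraMap_smul,
      ← TensorProduct.tmul_smul, h2]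

theorem cechTermToTensor_cechRes {U T : Finset (Fin l)} (h : U ⊆ T)
    (z : CechTerm (fun j => algebraMap R S (x j)) (S ⊗[R] M) U) :
    cechTermToTensor x M S T (cechRes _ _ h z) =
      (cechRes x M h).baseChange S (cechTermToTensor x M S U z) := by
  refine LinearMap.congr_fun (f := cechTermToTensor x M S T ∘ₗ cechRes _ _ h)
    (g := (cechRes x M h).baseChange S ∘ₗ cechTermToTensor x M S U) ?_ z
  refine IsLocalizedModule.ext _ (LocalizedModule.mkLinearMap _ _)
    (isUnit_algebraMap_end_tensor_cechTerm x M S h) ?_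
  refine LinearMap.ext fun z => ?_
  simp only [LinearMap.comp_apply, cechRes, LocalizedModule.liftOfLE,
    IsLocalizedModule.liftOfLE_apply, cechTermToTensor_mk]
  rw [← LinearMap.comp_apply, ← LinearMap.baseChange_comp, IsLocalizedModule.liftOfLE_comp]

/-- The full index set, as the only index in the top degree of the Čech complex. -/
abbrev topSubset (l : ℕ) : Subsets l l := ⟨Finset.univ, by simp⟩

theorem eq_topSubset (T : Subsets l l) : T = topSubset l :=
  Subtype.ext (Finset.card_eq_iff_eq_univ _ |>.1 (by simp [T.2]))

instance : IsEmpty (Subsets l (l + 1)) :=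
  ⟨fun T => by simpa [T.2] using Finset.card_le_univ T.1⟩

/-- The canonical map from the last term of the Čech complex to the top Čech cohomology. -/
def cechTopMk : CechTerm x M (topSubset l).1 →ₗ[R] CechCohomology x M l :=
  Submodule.mkQ _ ∘ₗ (LinearMap.single R (fun T : Subsets l l => CechTerm x M T.1)
    (topSubset l)).codRestrict _ fun _ => Subsingleton.elim _ _

theorem cechTopMk_surjective : Function.Surjective (cechTopMk x M) := by
  refine (Submodule.mkQ_surjective _).comp fun f => ⟨f.1 (topSubset l), Subtype.ext ?_⟩
  funext T
  obtain rfl := eq_topSubset T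
  exact Pi.single_eq_same _ _

/-- The restriction of `m` is, up to sign, the differential of the cochain concentrated at
`univ.erase j`. Length `l + 1` makes the top coboundaries the range of a differential. -/
theorem cechTopMk_cechRes {l : ℕ} (x : Fin (l + 1) → R) (j : Fin (l + 1))
    (m : CechTerm x M ((topSubset (l + 1)).1.erase j)) :
    cechTopMk x M (cechRes x M (Finset.erase_subset j _) m) = 0 := by
  refine (Submodule.Quotient.mk_eq_zero _).2 ?_
  have hc : ((topSubset (l + 1)).1.erase j).card = l := by simp
  -- The sign is its own inverse, so it cancels the one in the differential.
  refine ⟨posSign R (topSubset (l + 1)).1 j •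
    Pi.single (M := fun U : Subsets (l + 1) l => CechTerm x M U.1) ⟨_, hc⟩ m, ?_⟩
  funext T
  obtain rfl := eq_topSubset T
  rw [map_smul, Pi.smul_apply, cechD_apply, Finset.sum_eq_single ⟨j, Finset.mem_univ j⟩]
  · simp only [smul_smul]
    rw [Pi.single_eq_same, posSign, ← mul_pow, neg_one_mul, neg_neg, one_pow, one_smul]
    exact (Pi.single_eq_same (M := fun U : Subsets (l + 1) (l + 1) => CechTerm x M U.1)
      (topSubset (l + 1)) (cechRes x M (Finset.erase_subset j _) m)).symm
  · intro k _ hk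
    rw [Pi.single_eq_of_ne, map_zero, smul_zero]
    intro h
    have hk' : k.1 ∈ (topSubset (l + 1)).1.erase j :=
      Finset.mem_erase.2 ⟨fun e => hk (Subtype.ext e), Finset.mem_univ _⟩
    have h' : (topSubset (l + 1)).1.erase k.1 = (topSubset (l + 1)).1.erase j :=
      congrArg Subtype.val h
    exact Finset.notMem_erase k.1 _ (h' ▸ hk')
  · simp

/-- The canonical map `H^l_x(S ⊗ M) → S ⊗ H^l_x(M)` on top Čech cohomology. -/
def cechTopToTensor {l : ℕ} (x : Fin (l + 1) → R) :
    CechCohomology (fun j => algebraMap R S (x j)) (S ⊗[R] M) (l + 1) →ₗ[S]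
      S ⊗[R] CechCohomology x M (l + 1) :=
  Submodule.liftQ _ ((cechTopMk x M).baseChange S ∘ₗ cechTermToTensor x M S _ ∘ₗ
    LinearMap.proj (topSubset (l + 1)) ∘ₗ Submodule.subtype _) (by
    rintro ⟨_, hf⟩ ⟨f, rfl⟩
    simp only [LinearMap.mem_ker, LinearMap.comp_apply, Submodule.subtype_apply,
      LinearMap.proj_apply, cechD_apply, map_sum, map_smul, cechTermToTensor_cechRes]
    refine Finset.sum_eq_zero fun j _ => ?_
    rw [← LinearMap.comp_apply, ← LinearMap.baseChange_comp,
      (LinearMap.ext (cechTopMk_cechRes M x j.1) : cechTopMk x M ∘ₗ cechRes x M _ = 0)]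
    simp)

theorem cechTopToTensor_surjective {l : ℕ} (x : Fin (l + 1) → R) :
    Function.Surjective (cechTopToTensor M S x) := by
  intro z
  obtain ⟨a, rfl⟩ := LinearMap.lTensor_surjective S (cechTopMk_surjective x M) z
  obtain ⟨b, rfl⟩ := cechTermToTensor_surjective x M S _ a
  refine ⟨cechTopMk _ _ b, ?_⟩
  change (cechTopMk x M).baseChange S (cechTermToTensor x M S _ 
    (Pi.single (M := fun U : Subsets (l + 1) (l + 1) => CechTerm _ (S ⊗[R] M) U.1)
      (topSubset (l + 1)) b (topSubset (l + 1)))) = _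
  rw [Pi.single_eq_same]
  rfl

end Cech

/-! ### Ascent of parameter sequences and descent of Cohen–Macaulayness. -/

section BaseChange

variable {R : Type*} [CommRing R] {l : ℕ} {x : Fin l → R} {M : Type*} [AddCommGroup M] [Module R M]
variable (S : Type*) [CommRing S] [Algebra R S]

theorem span_range_algebraMap (x : Fin l → R) :
    Ideal.span (Set.range fun j => algebraMap R S (x j)) =
      (Ideal.span (Set.range x)).map (algebraMap R S) := by
  rw [Ideal.map_span, ← Set.range_comp]
  rfl

theorem one_tmul_mem_seqSMul {m : M} (hm : m ∈ seqSMul x M) :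
    (1 : S) ⊗ₜ[R] m ∈ seqSMul (fun j => algebraMap R S (x j)) (S ⊗[R] M) := by
  refine Submodule.smul_induction_on hm (fun r hr m _ => ?_) fun a b ha hb => ?_
  · rw [TensorProduct.tmul_smul, ← algebraMap_smul S]
    refine Submodule.smul_mem_smul ?_ Submodule.mem_top
    rw [span_range_algebraMap]
    exact Ideal.mem_map_of_mem _ hr
  · rw [TensorProduct.tmul_add]
    exact add_mem ha hb

/-- The canonical map `S ⊗ (M / xM) → (S ⊗ M) / x(S ⊗ M)` is surjective. -/
theorem exists_surjective_tensor_quotient (x : Fin l → R) (M : Type*) [AddCommGroup M]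
    [Module R M] :
    ∃ f : S ⊗[R] (M ⧸ seqSMul x M) →ₗ[S]
      (S ⊗[R] M) ⧸ seqSMul (fun j => algebraMap R S (x j)) (S ⊗[R] M),
      Function.Surjective f := by
  set N := seqSMul (fun j => algebraMap R S (x j)) (S ⊗[R] M)
  let g : M →ₗ[R] (S ⊗[R] M) ⧸ N := (N.mkQ.restrictScalars R) ∘ₗ TensorProduct.mk R S M 1
  have hg : seqSMul x M ≤ LinearMap.ker g := fun m hm =>
    (Submodule.Quotient.mk_eq_zero _).2 (one_tmul_mem_seqSMul S hm)
  refine ⟨((seqSMul x M).liftQ g hg).liftBaseChange S, fun z => ?_⟩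
  obtain ⟨z, rfl⟩ := N.mkQ_surjective z
  refine ⟨LinearMap.lTensor S (seqSMul x M).mkQ z, ?_⟩
  induction z with
  | zero => simp
  | add a b ha hb => simp only [map_add, ha, hb]
  | tmul s m =>
    rw [LinearMap.lTensor_tmul, LinearMap.liftBaseChange_tmul, Submodule.mkQ_apply,
      Submodule.liftQ_apply]
    change s • N.mkQ (1 ⊗ₜ m) = _
    rw [← map_smul, TensorProduct.smul_tmul', smul_eq_mul, mul_one]

/-- Parameter sequences are preserved by faithfully flat base change. -/
theorem IsParameterSequence.baseChange [Module.FaithfullyFlat R S] (hl : 1 ≤ l)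
    (hx : IsParameterSequence x M) :
    IsParameterSequence (fun j => algebraMap R S (x j)) (S ⊗[R] M) where
  weaklyProregular := hx.weaklyProregular.baseChange S
  ne_top := by
    rw [seqSMul, span_range_algebraMap]
    exact ((TensorProduct.isBaseChange R M S).map_smul_top_ne_top_iff_of_faithfullyFlat
      R M _).2 hx.ne_top
  cech_ne_zero q hq := by
    obtain ⟨l, rfl⟩ : ∃ k, l = k + 1 := ⟨l - 1, by omega⟩
    obtain ⟨f, hf⟩ := exists_surjective_tensor_quotient S x M
    exact Module.support_subset_of_surjective (cechTopToTensor M S x)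
      (cechTopToTensor_surjective M S x) (mem_support_tensorProduct_of_flat
        (hx.cech_ne_zero _ (comap_mem_support_of_mem_support_tensorProduct
          (Module.support_subset_of_surjective f hf hq))))

/-- The Cohen–Macaulay property descends along faithfully flat ring homomorphisms. -/
theorem IsCohenMacaulay.of_faithfullyFlat [Module.FaithfullyFlat R S]
    (h : IsCohenMacaulay S (S ⊗[R] M)) : IsCohenMacaulay R M := by
  intro l x hx
  rcases Nat.eq_zero_or_pos l with rfl | hl
  · exact Or.inl rfl
  refine Or.inr ⟨?_, ?_⟩
  · have hS := (h l (fun j => algebraMap R S (x j))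
      fun i hi h1 => (hx i hi h1).baseChange S h1).resolve_left hl.ne'
    refine isWeaklyRegular_of_faithfullyFlat S ?_
    rw [List.map_ofFn]
    exact hS.1
  -- Properness needs no descent: it is part of `x` being a parameter sequence on `M`.
  · have := (hx l le_rfl hl).ne_top
    rw [seqSMul] at this
    convert this.symm using 2
    rw [Ideal.ofList]
    congr 1
    ext a
    simp [List.mem_ofFn]

end BaseChange

/-- Evaluation into the residue field kills the maximal ideal times the completion but not `1`, so
that product is proper. -/
theorem faithfullyFlat_adicCompletion (R : Type*) [CommRing R] [IsLocalRing R]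
    [Module.Flat R (AdicCompletion (IsLocalRing.maximalIdeal R) R)] :
    Module.FaithfullyFlat R (AdicCompletion (IsLocalRing.maximalIdeal R) R) where
  submodule_ne_top m hm h := by
    obtain rfl := IsLocalRing.eq_maximalIdeal hm
    set I := IsLocalRing.maximalIdeal R
    have key : (⊤ : Submodule R (AdicCompletion I R)) ≤
        LinearMap.ker (AdicCompletion.evalOneₐ I).toLinearMap := by
      rw [← h, Submodule.smul_le]
      intro r hr z _
      rw [LinearMap.mem_ker, map_smul]
      obtain ⟨y, hy⟩ := Ideal.Quotient.mk_surjective ((AdicCompletion.evalOneₐ I).toLinearMap z)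
      rw [← hy, Algebra.smul_def]
      exact Ideal.Quotient.eq_zero_iff_mem.2 (I.mul_mem_right _ hr)
    have h1 : AdicCompletion.evalOneₐ I 1 = 0 := key (Submodule.mem_top (x := 1))
    rw [map_one] at h1
    have : Nontrivial (R ⧸ I) := Ideal.Quotient.nontrivial_iff.2 hm.ne_top
    exact one_ne_zero h1

theorem faithfullyFlat_polynomial (R : Type*) [CommRing R] :
    Module.FaithfullyFlat R (Polynomial R) := by
  rcases subsingleton_or_nontrivial R with h | h
  -- The zero ring has no maximal ideals, so the condition is vacuous.
  · exact ⟨fun m hm => (hm.ne_top (Subsingleton.elim _ _)).elim⟩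
  · infer_instance

end HMCohenMacaulay

end
theorem mainTheorem7 :
    (∀ (R : Type u) [CommRing R] (S : Type v) [CommRing S] [Algebra R S]
        [Module.FaithfullyFlat R S] (M : Type w) [AddCommGroup M] [Module R M],
        HMCohenMacaulay.IsCohenMacaulay S (S ⊗[R] M) → HMCohenMacaulay.IsCohenMacaulay R M) ∧
    (∀ (R : Type u) [CommRing R] [IsLocalRing R]
        [Module.Flat R (AdicCompletion (IsLocalRing.maximalIdeal R) R)]
        (M : Type w) [AddCommGroup M] [Module R M],
        HMCohenMacaulay.IsCohenMacaulay (AdicCompletion (IsLocalRing.maximalIdeal R) R)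
          (AdicCompletion (IsLocalRing.maximalIdeal R) R ⊗[R] M) →
        HMCohenMacaulay.IsCohenMacaulay R M) ∧
    (∀ (R : Type u) [CommRing R] [IsLocalRing R] [IsNoetherianRing R]
        (M : Type w) [AddCommGroup M] [Module R M],
        HMCohenMacaulay.IsCohenMacaulay (AdicCompletion (IsLocalRing.maximalIdeal R) R)
          (AdicCompletion (IsLocalRing.maximalIdeal R) R ⊗[R] M) →
        HMCohenMacaulay.IsCohenMacaulay R M) ∧
    (∀ (R : Type u) [CommRing R] (M : Type w) [AddCommGroup M] [Module R M],
        HMCohenMacaulay.IsCohenMacaulay (Polynomial R) (Polynomial R ⊗[R] M) →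
        HMCohenMacaulay.IsCohenMacaulay R M) := by
  refine ⟨fun R _ S _ _ _ M _ _ h => h.of_faithfullyFlat S, fun R _ _ _ M _ _ h => ?_,
    fun R _ _ _ M _ _ h => ?_, fun R _ M _ _ h => ?_⟩
  · have := HMCohenMacaulay.faithfullyFlat_adicCompletion R
    exact h.of_faithfullyFlat _
  -- Here flatness of the completion is inferred from the Noetherian hypothesis.
  · have := HMCohenMacaulay.faithfullyFlat_adicCompletion R
    exact h.of_faithfullyFlat _
  · have := HMCohenMacaulay.faithfullyFlat_polynomial R
    exact h.of_faithfullyFlat _
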